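/- Let $\mathbb{H}^2$ be the hyperbolic plane of curvature $-1$, and let $O\in\mathbb{H}^2$ be a fixed point (the origin). A convex body is a compact set $K\subset\mathbb{H}^2$ that is the closure of its nonempty interior and contains, with any two of its points, the geodesic segment joining them. A supporting geodesic of $K$ is a geodesic line that meets $K$ but not the interior of $K$. If $\partial K$ is a $C^1$-smooth (regular, simple, closed) curve and $x\in\partial K$, let $n_K(x)$ be the normal geodesic at $x$, i.e. the geodesic line that is perpendicular at $x$ to the supporting geodesic of $K$ through $x$; let $\Gamma_2$ be the other supporting geodesic of $K$ that is orthogonal to $n_K(x)$, and let $\phi(x)$ be the point where $\Gamma_2$ meets $n_K(x)$. The width of $K$ at $x$ is the length $|[x,\phi(x)]|$, and $K$ has constant width $w$ if its width at every $x\in\partial K$ is $w$. The projection of $K$ onto a geodesic line $\Gamma$ is the geodesic segment $P_\Gamma(K)$ of all $x\in\Gamma$ such that the geodesic line perpendicular to $\Gamma$ at $x$ meets $K$. Theorem. Let $K\subset\mathbb{H}^2$ be a convex body of constant width $w$ such that $\partial K$ is a $C^1$-smooth curve and $O$ is an interior point of $K$. If the projections $P_\Gamma(K)$ onto all geodesic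 lines $\Gamma$ through $O$ have the same length, then $K$ is a disc, i.e. $K=\{x : d(x,c)\le r\}$ for some $c\in\mathbb{H}^2$ and $r>0$, where $d$ is the hyperbolic distance. -/

import Mathlib

open scoped UpperHalfPlane

/-! The hyperbolic plane is Mathlib's upper half-plane `ℍ` with its Poincaré metric
(constant curvature `-1`); all topological and metric notions below refer to it. -/

namespace HypPlane

/-- The vertical half-line over the real number `a`. -/
def verticalLine (a : ℝ) : Set ℍ := {z | z.re = a}

/-- The half-circle with Euclidean centre `c` on the real axis and Euclidean radius `r`. -/
def halfCircle (c r : ℝ) : Set ℍ := {z | (z.re - c) ^ 2 + z.im ^ 2 = r ^ 2}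

/-- The (complete) geodesic lines of the upper half-plane model. -/
def IsGeodesic (L : Set ℍ) : Prop :=
  (∃ a : ℝ, L = verticalLine a) ∨ (∃ c r : ℝ, 0 < r ∧ L = halfCircle c r)

/-- `v` is a nonzero tangent vector at the point `p` of the geodesic line `L`: it is vertical if
`L` is a vertical half-line, and orthogonal to the Euclidean radius if `L` is a half-circle. -/
def IsTangentVector (L : Set ℍ) (p : ℍ) (v : ℂ) : Prop :=
  p ∈ L ∧ v ≠ 0 ∧
    ((∃ a : ℝ, L = verticalLine a ∧ v.re = 0) ∨
      (∃ c r : ℝ, 0 < r ∧ L = halfCircle c r ∧ inner ℝ ((p : ℂ) - (c : ℂ)) v = 0))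

/-- The geodesic lines `L` and `M` meet at `p` and are perpendicular there. The model is
conformal, so this is Euclidean orthogonality of the tangent vectors. -/
def PerpAt (L M : Set ℍ) (p : ℍ) : Prop :=
  ∃ u v : ℂ, IsTangentVector L p u ∧ IsTangentVector M p v ∧ inner ℝ u v = 0

/-- The geodesic segment `[x, y]`. -/
def geodesicSegment (x y : ℍ) : Set ℍ := {z | dist x z + dist z y = dist x y}

/-- A convex body: a compact set that is the closure of its nonempty interior and contains with
any two points the geodesic segment joining them. -/
structure IsConvexBody (K : Set ℍ) : Prop where
  isCompact : IsCompact K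
  interior_nonempty : (interior K).Nonempty
  closure_interior : closure (interior K) = K
  convex : ∀ x ∈ K, ∀ y ∈ K, geodesicSegment x y ⊆ K

/-- `S` is a `C¹`-smooth simple closed curve, i.e. it has a regular periodic `C¹` parametrization
that is injective on a period. -/
def IsC1ClosedCurve (S : Set ℍ) : Prop :=
  ∃ γ : ℝ → ℂ, ContDiff ℝ 1 γ ∧ (∀ t, deriv γ t ≠ 0) ∧ Function.Periodic γ 1 ∧
    Set.InjOn γ (Set.Ico 0 1) ∧ Set.range γ = (fun z : ℍ => (z : ℂ)) '' S

/-- `G` is a supporting geodesic of `K`: it touches `K` but misses the interior of `K`. -/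
def IsSupporting (K G : Set ℍ) : Prop :=
  IsGeodesic G ∧ (G ∩ K).Nonempty ∧ Disjoint G (interior K)

/-- `N` is the normal geodesic of `K` at its boundary point `x`, and `G` is a supporting geodesic
at `x` to which it is perpendicular. -/
def IsNormalAt (K : Set ℍ) (x : ℍ) (G N : Set ℍ) : Prop :=
  x ∈ frontier K ∧ IsSupporting K G ∧ PerpAt G N x

/-- `K` has width `w` at its boundary point `x`: if `N` is the normal geodesic at `x` and `G₂` is
the other supporting geodesic orthogonal to `N`, meeting `N` at `y`, then `[x, y]` has
length `w`. For a convex body with `C¹` boundary, `N`, `G₂` and `y` exist and are unique. -/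
def HasWidthAt (K : Set ℍ) (x : ℍ) (w : ℝ) : Prop :=
  ∃ (G₁ N G₂ : Set ℍ) (y : ℍ), IsNormalAt K x G₁ N ∧
    IsSupporting K G₂ ∧ G₂ ≠ G₁ ∧ PerpAt G₂ N y ∧ dist x y = w

/-- `K` has constant width `w`. -/
def HasConstantWidth (K : Set ℍ) (w : ℝ) : Prop :=
  ∀ x ∈ frontier K, HasWidthAt K x w

/-- The projection of `K` onto the geodesic `G`: the points `x` of `G` such that the geodesic
perpendicular to `G` at `x` meets `K`. -/
def projection (G K : Set ℍ) : Set ℍ :=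
  {x | x ∈ G ∧ ∃ N, PerpAt N G x ∧ (K ∩ N).Nonempty}

/-- The length of the projection of `K` onto `G`. The projection of a convex body is a geodesic
segment, whose length is the distance of its endpoints, that is, its diameter. -/
noncomputable def projectionLength (G K : Set ℍ) : ℝ := Metric.diam (projection G K)

end HypPlane

/-!
The proof works in the hyperboloid model. The map `hyp` sends a point of `ℍ` to a vector `X` of
Lorentzian square `-1`, with `lor (hyp z) (hyp w) = -cosh (dist z w)`, and the geodesic lines are
the sets `line n = {z | lor n (hyp z) = 0}` with `lor n n = 1`; perpendicularity of two lines
becomes orthogonality of their vectors. A supporting geodesic of `K` is a `line n` with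
`lor n (hyp z) ≤ 0` for all `z` in `K` and equality for some `z` in `K` (`IsSupportNormal`); here
`-lor n (hyp z)` is the hyperbolic sine of the distance from `z` to the geodesic. Since the
boundary is `C¹`, the supporting geodesic at a boundary point is unique, so constant width says: if `line n`
supports `K` at `x`, then `sinh w • hyp x - cosh w • n` is a support normal too
(`HasConstantWidth.opposite`).

The theorem then follows from three observations.

* No point of `K` has distance more than `w` from a supporting geodesic `line n`
  (`HasConstantWidth.neg_lor_le`): at a farthest point `z` the geodesic perpendicular to the one
  dropped from `z` to `line n` supports `K`, and `line n` is its opposite supporting geodesic.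
* The common length of the projections is `w` (`projectionLength_eq_width`): at the point `x` of
  `K` farthest from `o`, the normal is the geodesic through `o`, and the projection onto it has
  the width at `x` as its length.
* Let `y` be the foot of the perpendicular from `o` to a supporting geodesic at `x`. The
  projection onto this perpendicular has length `w`, so the opposite supporting geodesic
  perpendicular to it is at distance `w`, and `y` is the only point of the given one within
  distance `w` of it. As `x` is within distance `w` by the first observation, `x = y`
  (`exists_hyp_eq_add_of_projectionLength`).

Hence all normals pass through `o`, the distance to `o` is constant along the boundary curve, and
`K` is a ball around `o`.
-/

namespace HypPlane

/-! ### The hyperboloid model -/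

/-- The Lorentzian form of signature `(2, 1)` on `ℝ³` for which `(A, B, C)` has square
`B ^ 2 - A * C`. -/
noncomputable def lor (u v : ℝ × ℝ × ℝ) : ℝ :=
  u.2.1 * v.2.1 - (u.1 * v.2.2 + u.2.2 * v.1) / 2

lemma lor_comm (u v : ℝ × ℝ × ℝ) : lor u v = lor v u := by
  simp only [lor]; ring

lemma lor_add_left (u v x : ℝ × ℝ × ℝ) : lor (u + v) x = lor u x + lor v x := by
  simp only [lor, Prod.fst_add, Prod.snd_add]; ring

lemma lor_smul_left (a : ℝ) (u x : ℝ × ℝ × ℝ) : lor (a • u) x = a * lor u x := by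
  simp only [lor, Prod.smul_fst, Prod.smul_snd, smul_eq_mul]; ring

lemma lor_sub_left (u v x : ℝ × ℝ × ℝ) : lor (u - v) x = lor u x - lor v x := by
  simp only [lor, Prod.fst_sub, Prod.snd_sub]; ring

lemma lor_neg_left (u x : ℝ × ℝ × ℝ) : lor (-u) x = -lor u x := by
  simp only [lor, Prod.fst_neg, Prod.snd_neg]; ring

lemma lor_add_right (x u v : ℝ × ℝ × ℝ) : lor x (u + v) = lor x u + lor x v := by
  simp only [lor, Prod.fst_add, Prod.snd_add]; ring

lemma lor_smul_right (a : ℝ) (x u : ℝ × ℝ × ℝ) : lor x (a • u) = a * lor x u := by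
  simp only [lor, Prod.smul_fst, Prod.smul_snd, smul_eq_mul]; ring

lemma lor_sub_right (x u v : ℝ × ℝ × ℝ) : lor x (u - v) = lor x u - lor x v := by
  simp only [lor, Prod.fst_sub, Prod.snd_sub]; ring

lemma lor_neg_right (x u : ℝ × ℝ × ℝ) : lor x (-u) = -lor x u := by
  simp only [lor, Prod.fst_neg, Prod.snd_neg]; ring

lemma eq_of_cosh_eq {a b : ℝ} (ha : 0 ≤ a) (hb : 0 ≤ b) (h : Real.cosh a = Real.cosh b) :
    a = b := by
  have h' : |a| = |b| := le_antisymm (Real.cosh_le_cosh.1 h.le) (Real.cosh_le_cosh.1 h.ge)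
  rwa [abs_of_nonneg ha, abs_of_nonneg hb] at h'

/-- The point `((x² + y²) / y, x / y, 1 / y)` of the hyperboloid that represents `x + i y`. It is
defined on all of `ℂ` so that it can be differentiated along curves. -/
noncomputable def hyp (z : ℂ) : ℝ × ℝ × ℝ :=
  ((z.re ^ 2 + z.im ^ 2) / z.im, z.re / z.im, 1 / z.im)

/-- The derivative of `hyp` at `z` in the direction `v`. -/
noncomputable def hypDeriv (z v : ℂ) : ℝ × ℝ × ℝ :=
  (2 * z.re / z.im * v.re + (1 - z.re ^ 2 / z.im ^ 2) * v.im,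
    v.re / z.im - z.re * v.im / z.im ^ 2, -v.im / z.im ^ 2)

lemma lor_hyp_self (z : ℍ) : lor (hyp z) (hyp z) = -1 := by
  have := z.im_pos.ne'
  simp only [lor, hyp, UpperHalfPlane.coe_re, UpperHalfPlane.coe_im]
  field_simp
  ring

lemma lor_hyp (z w : ℍ) : lor (hyp z) (hyp w) = -Real.cosh (dist z w) := by
  have h1 := z.im_pos.ne'
  have h2 := w.im_pos.ne'
  rw [UpperHalfPlane.cosh_dist, Complex.dist_eq, Complex.sq_norm, Complex.normSq_apply]
  simp only [lor, hyp, UpperHalfPlane.coe_re, UpperHalfPlane.coe_im, Complex.sub_re,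
    Complex.sub_im]
  field_simp
  ring

lemma lor_hyp_le (z w : ℍ) : lor (hyp z) (hyp w) ≤ -1 := by
  rw [lor_hyp]; linarith [Real.one_le_cosh (dist z w)]

lemma eq_of_lor_hyp (z w : ℍ) (h : -1 ≤ lor (hyp z) (hyp w)) : z = w := by
  rw [lor_hyp] at h
  have h1 : Real.cosh (dist z w) ≤ Real.cosh 0 := by rw [Real.cosh_zero]; linarith
  rw [Real.cosh_le_cosh, abs_zero, abs_of_nonneg dist_nonneg] at h1
  exact dist_le_zero.1 h1

lemma lor_hypDeriv_hyp (z : ℍ) (v : ℂ) : lor (hypDeriv z v) (hyp z) = 0 := by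
  have := z.im_pos.ne'
  simp only [lor, hyp, hypDeriv, UpperHalfPlane.coe_re, UpperHalfPlane.coe_im]
  field_simp
  ring

/-- `hyp` is an isometric embedding of the Poincaré metric. -/
lemma lor_hypDeriv (z : ℍ) (u v : ℂ) :
    lor (hypDeriv z u) (hypDeriv z v) = inner ℝ u v / z.im ^ 2 := by
  have := z.im_pos.ne'
  rw [Complex.inner]
  simp only [lor, hypDeriv, UpperHalfPlane.coe_re, UpperHalfPlane.coe_im, Complex.mul_re,
    Complex.conj_re, Complex.conj_im]
  field_simp
  ring

lemma hypDeriv_ne_zero (z : ℍ) {v : ℂ} (hv : v ≠ 0) : hypDeriv z v ≠ 0 := by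
  intro h0
  have h1 := lor_hypDeriv z v v
  rw [h0, real_inner_self_eq_norm_sq] at h1
  have h2 : 0 < ‖v‖ ^ 2 / z.im ^ 2 := by
    have := z.im_pos
    have := norm_pos_iff.2 hv
    positivity
  rw [← h1] at h2
  simp [lor] at h2

/-- Every vector orthogonal to `hyp z` is tangent to the hyperboloid at `hyp z`. -/
lemma exists_hypDeriv (z : ℍ) (n : ℝ × ℝ × ℝ) (h : lor n (hyp z) = 0) :
    ∃ v : ℂ, n = hypDeriv z v := by
  have := z.im_pos.ne'
  obtain ⟨a, b, c⟩ := n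
  refine ⟨⟨z.im * b - z.re * z.im * c, -c * z.im ^ 2⟩, ?_⟩
  simp only [lor, hyp, UpperHalfPlane.coe_re, UpperHalfPlane.coe_im] at h
  field_simp at h
  simp only [hypDeriv, UpperHalfPlane.coe_re, UpperHalfPlane.coe_im, Prod.mk.injEq]
  refine ⟨?_, ?_, ?_⟩
  · field_simp
    linear_combination -h
  · field_simp
    ring
  · field_simp

/-- Two vectors orthogonal to `k` in the positive definite plane orthogonal to `hyp z` are
proportional. -/
lemma eq_smul_of_lor_eq_zero (z : ℍ) {k n u : ℝ × ℝ × ℝ} (hkz : lor k (hyp z) = 0)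
    (hnz : lor n (hyp z) = 0) (huz : lor u (hyp z) = 0) (hk : k ≠ 0) (hn : lor n n = 1)
    (hkn : lor k n = 0) (hku : lor k u = 0) : u = lor u n • n := by
  have hy := z.im_pos.ne'
  obtain ⟨κ, rfl⟩ := exists_hypDeriv z k hkz
  obtain ⟨ν, rfl⟩ := exists_hypDeriv z n hnz
  obtain ⟨μ, rfl⟩ := exists_hypDeriv z u huz
  have hc : lor (hypDeriv z μ) (hypDeriv z ν) = (μ.re * ν.re + μ.im * ν.im) / z.im ^ 2 := by
    rw [lor_hypDeriv, Complex.inner]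
    simp only [Complex.mul_re, Complex.conj_re, Complex.conj_im]
    ring
  rw [hc]
  rw [lor_hypDeriv, Complex.inner] at hn hkn hku
  simp only [Complex.mul_re, Complex.conj_re, Complex.conj_im] at hn hkn hku
  have hκ : κ.re ≠ 0 ∨ κ.im ≠ 0 := by
    by_contra! h0
    apply hk
    simp [hypDeriv, h0.1, h0.2]
  field_simp at hn hkn hku
  have h1 : μ.re * ν.im = μ.im * ν.re := by
    rcases hκ with h | h
    · apply mul_left_cancel₀ h
      linear_combination ν.im * hku - μ.im * hkn
    · apply mul_left_cancel₀ h
      linear_combination -ν.re * hku + μ.re * hkn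
  have h2 : μ.re = (μ.re * ν.re + μ.im * ν.im) / z.im ^ 2 * ν.re := by
    field_simp
    linear_combination -μ.re * hn + ν.im * h1
  have h3 : μ.im = (μ.re * ν.re + μ.im * ν.im) / z.im ^ 2 * ν.im := by
    field_simp
    linear_combination -μ.im * hn - ν.re * h1
  generalize (μ.re * ν.re + μ.im * ν.im) / z.im ^ 2 = c at h2 h3 ⊢
  simp only [hypDeriv, h2, h3, Prod.smul_mk, smul_eq_mul, Prod.mk.injEq]
  refine ⟨?_, ?_, ?_⟩ <;> ring

/-- The vectors orthogonal to `k` are spanned by `hyp z` and a unit tangent vector `n`. -/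
lemma eq_smul_hyp_add_smul (z : ℍ) {k n v : ℝ × ℝ × ℝ} (hkz : lor k (hyp z) = 0)
    (hnz : lor n (hyp z) = 0) (hk : k ≠ 0) (hn : lor n n = 1) (hkn : lor k n = 0)
    (hkv : lor k v = 0) : v = (-lor v (hyp z)) • hyp z + lor v n • n := by
  have := eq_smul_of_lor_eq_zero z hkz hnz (u := v + lor v (hyp z) • hyp z)
    (by rw [lor_add_left, lor_smul_left, lor_hyp_self]; ring) hk hn hkn
    (by rw [lor_add_right, lor_smul_right, hkv, hkz]; ring)
  rw [lor_add_left, lor_smul_left, lor_comm (hyp z) n, hnz, mul_zero, add_zero] at this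
  rw [neg_smul, ← this]
  abel

/-- The Cauchy–Schwarz inequality in the tangent plane at `hyp z`. -/
lemma lor_sq_le (z : ℍ) {u n : ℝ × ℝ × ℝ} (huz : lor u (hyp z) = 0)
    (hnz : lor n (hyp z) = 0) : lor u n ^ 2 ≤ lor u u * lor n n := by
  obtain ⟨ν, rfl⟩ := exists_hypDeriv z n hnz
  obtain ⟨μ, rfl⟩ := exists_hypDeriv z u huz
  simp only [lor_hypDeriv, div_pow, div_mul_div_comm, ← pow_mul, ← pow_add]
  have := real_inner_mul_inner_self_le μ ν
  gcongr
  linarith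

lemma exists_orthogonal (z : ℍ) {n : ℝ × ℝ × ℝ} (hnz : lor n (hyp z) = 0) (hn : lor n n = 1) :
    ∃ k, lor k k = 1 ∧ lor k (hyp z) = 0 ∧ lor k n = 0 := by
  obtain ⟨ν, rfl⟩ := exists_hypDeriv z n hnz
  refine ⟨hypDeriv z ⟨-ν.im, ν.re⟩, ?_, lor_hypDeriv_hyp z _, ?_⟩
  · rw [lor_hypDeriv, Complex.inner] at *
    simp only [Complex.mul_re, Complex.conj_re, Complex.conj_im] at *
    rw [← hn]; ring
  · rw [lor_hypDeriv, Complex.inner]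
    simp only [Complex.mul_re, Complex.conj_re, Complex.conj_im]
    ring

/-- A vector of square `-1` in the same cone as a point of the hyperboloid represents a point. -/
lemma exists_hyp_eq (p : ℍ) {v : ℝ × ℝ × ℝ} (hv : lor v v = -1) (h : lor v (hyp p) < 0) :
    ∃ z : ℍ, hyp z = v := by
  have key : ∀ u : ℝ × ℝ × ℝ, lor u u = -1 → 0 < u.2.2 → ∃ z : ℍ, hyp z = u := by
    rintro ⟨a, b, c⟩ hu hc
    simp only [lor] at hu hc
    refine ⟨⟨⟨b / c, 1 / c⟩, by positivity⟩, ?_⟩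
    simp only [hyp, Prod.mk.injEq]
    refine ⟨?_, ?_, ?_⟩
    · field_simp
      linear_combination hu
    · field_simp
    · field_simp
  rcases lt_trichotomy v.2.2 0 with h0 | h0 | h0
  · obtain ⟨z, hz⟩ := key (-v) (by rw [lor_neg_left, lor_neg_right, hv, neg_neg])
      (by simpa using h0)
    have := lor_hyp_le z p
    rw [hz, lor_neg_left] at this
    linarith
  · simp only [lor, h0] at hv
    nlinarith [sq_nonneg v.2.1]
  · exact key v hv h0

/-- The unit speed geodesic through `x` with unit initial velocity `e`. -/
lemma exists_geodesic (x : ℍ) {e : ℝ × ℝ × ℝ} (he : lor e e = 1) (hx : lor e (hyp x) = 0) :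
    ∃ c : ℝ → ℍ, Isometry c ∧ ∀ t, hyp (c t) = Real.cosh t • hyp x + Real.sinh t • e := by
  have h : ∀ t : ℝ, ∃ z : ℍ, hyp z = Real.cosh t • hyp x + Real.sinh t • e := by
    intro t
    apply exists_hyp_eq x
    · simp only [lor_add_left, lor_add_right, lor_smul_left, lor_smul_right, lor_hyp_self, he,
        hx, lor_comm (hyp x) e]
      linear_combination -Real.cosh_sq_sub_sinh_sq t
    · simp only [lor_add_left, lor_smul_left, lor_hyp_self, hx]
      linarith [Real.cosh_pos t]
  choose c hc using h
  refine ⟨c, Isometry.of_dist_eq fun s t => ?_, hc⟩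
  have h1 : Real.cosh (dist (c s) (c t)) = Real.cosh (s - t) := by
    rw [← neg_inj, ← lor_hyp, hc, hc]
    simp only [lor_add_left, lor_add_right, lor_smul_left, lor_smul_right, lor_hyp_self, he,
      hx, lor_comm (hyp x) e]
    rw [Real.cosh_sub]; ring
  rw [← Real.cosh_abs (s - t)] at h1
  exact eq_of_cosh_eq dist_nonneg (abs_nonneg _) h1

lemma hyp_injective {z w : ℍ} (h : hyp z = hyp w) : z = w := by
  apply eq_of_lor_hyp
  rw [h, lor_hyp_self]

lemma exists_geodesic_between (o p : ℍ) (hne : o ≠ p) :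
    ∃ c : ℝ → ℍ, Isometry c ∧ c 0 = o ∧ c (dist o p) = p := by
  have hd : 0 < dist o p := dist_pos.2 hne
  have hs : 0 < Real.sinh (dist o p) := Real.sinh_pos_iff.2 hd
  have hsq := Real.cosh_sq_sub_sinh_sq (dist o p)
  obtain ⟨c, hc, h⟩ := exists_geodesic o
    (e := (Real.sinh (dist o p))⁻¹ • (hyp p - Real.cosh (dist o p) • hyp o))
    (by
      simp only [lor_smul_left, lor_smul_right, lor_sub_left, lor_sub_right, lor_hyp_self,
        lor_hyp, dist_comm p o]
      field_simp
      linear_combination hsq)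
    (by
      simp only [lor_smul_left, lor_sub_left, lor_hyp_self, lor_hyp, dist_comm p o]
      ring)
  refine ⟨c, hc, hyp_injective ?_, hyp_injective ?_⟩
  · simp [h]
  · rw [h, smul_smul, mul_inv_cancel₀ hs.ne', one_smul]
    abel

lemma continuous_lor_hyp (n : ℝ × ℝ × ℝ) : Continuous fun z : ℍ => lor n (hyp z) := by
  simp only [lor, hyp, UpperHalfPlane.coe_re, UpperHalfPlane.coe_im]
  have h1 := UpperHalfPlane.continuous_re
  have h2 := UpperHalfPlane.continuous_im
  have h3 : ∀ z : ℍ, z.im ≠ 0 := fun z => z.im_pos.ne'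
  fun_prop (disch := assumption)

/-! ### Geodesics as orthogonal complements of unit vectors -/

/-- The geodesic line of all points whose hyperboloid vector is orthogonal to `n`; the vector `n`
will always satisfy `lor n n = 1`. -/
def line (n : ℝ × ℝ × ℝ) : Set ℍ := {z | lor n (hyp z) = 0}

lemma verticalLine_eq_line (a : ℝ) : verticalLine a = line (2 * a, 1, 0) := by
  ext z
  have := z.im_pos.ne'
  simp only [verticalLine, line, lor, hyp, Set.mem_ofPred_eq, UpperHalfPlane.coe_re,
    UpperHalfPlane.coe_im]
  field_simp
  constructor <;> intro h <;> linarith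

lemma halfCircle_eq_line (c : ℝ) {r : ℝ} (hr : 0 < r) :
    halfCircle c r = line ((c ^ 2 - r ^ 2) / r, c / r, 1 / r) := by
  ext z
  have := z.im_pos.ne'
  simp only [halfCircle, line, lor, hyp, Set.mem_ofPred_eq, UpperHalfPlane.coe_re,
    UpperHalfPlane.coe_im]
  field_simp
  constructor <;> intro h <;> linarith

lemma line_neg (n : ℝ × ℝ × ℝ) : line (-n) = line n := by
  ext z
  simp [line, lor_neg_left]

lemma lor_vertical (a : ℝ) : lor (2 * a, 1, 0) (2 * a, 1, 0) = 1 := by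
  simp [lor]

lemma lor_circle (c : ℝ) {r : ℝ} (hr : 0 < r) :
    lor ((c ^ 2 - r ^ 2) / r, c / r, 1 / r) ((c ^ 2 - r ^ 2) / r, c / r, 1 / r) = 1 := by
  simp only [lor]
  field_simp
  ring

lemma IsGeodesic.exists_line {L : Set ℍ} (h : IsGeodesic L) : ∃ n, lor n n = 1 ∧ L = line n := by
  rcases h with ⟨a, rfl⟩ | ⟨c, r, hr, rfl⟩
  · exact ⟨_, lor_vertical a, verticalLine_eq_line a⟩
  · exact ⟨_, lor_circle c hr, halfCircle_eq_line c hr⟩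

/-- The normal vector of a vertical line or of a half-circle, up to sign. -/
lemma line_cases {n : ℝ × ℝ × ℝ} (hn : lor n n = 1) :
    (∃ a, n = (2 * a, 1, 0) ∨ n = -(2 * a, 1, 0)) ∨ ∃ c r : ℝ, 0 < r ∧
      (n = ((c ^ 2 - r ^ 2) / r, c / r, 1 / r) ∨ n = -((c ^ 2 - r ^ 2) / r, c / r, 1 / r)) := by
  obtain ⟨a, b, c⟩ := n
  simp only [lor] at hn
  have key : ∀ a b c : ℝ, b ^ 2 - a * c = 1 → 0 < c → 0 < 1 / c ∧
      (a, b, c) = (((b / c) ^ 2 - (1 / c) ^ 2) / (1 / c), b / c / (1 / c), 1 / (1 / c)) := by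
    intro a b c h hc
    refine ⟨by positivity, ?_⟩
    simp only [Prod.mk.injEq]
    refine ⟨?_, ?_, ?_⟩
    · field_simp
      linear_combination -h
    · field_simp
    · field_simp
  rcases lt_trichotomy c 0 with hc | rfl | hc
  · obtain ⟨h1, h2⟩ := key (-a) (-b) (-c) (by linear_combination hn) (by linarith)
    refine Or.inr ⟨-b / -c, 1 / -c, h1, Or.inr ?_⟩
    rw [← h2]; simp
  · have : (b - 1) * (b + 1) = 0 := by linear_combination hn
    rcases mul_eq_zero.1 this with h | h
    · obtain rfl : b = 1 := by linarith
      exact Or.inl ⟨a / 2, Or.inl (by simp; ring)⟩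
    · obtain rfl : b = -1 := by linarith
      exact Or.inl ⟨-a / 2, Or.inr (by simp; ring)⟩
  · obtain ⟨h1, h2⟩ := key a b c (by linear_combination hn) hc
    exact Or.inr ⟨_, _, h1, Or.inl h2⟩

lemma isGeodesic_line {n : ℝ × ℝ × ℝ} (hn : lor n n = 1) : IsGeodesic (line n) := by
  rcases line_cases hn with ⟨a, rfl | rfl⟩ | ⟨c, r, hr, rfl | rfl⟩
  · exact Or.inl ⟨a, (verticalLine_eq_line a).symm⟩
  · exact Or.inl ⟨a, by rw [line_neg, verticalLine_eq_line a]⟩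
  · exact Or.inr ⟨c, r, hr, (halfCircle_eq_line c hr).symm⟩
  · exact Or.inr ⟨c, r, hr, by rw [line_neg, halfCircle_eq_line c hr]⟩

lemma lor_hypDeriv_vertical (a : ℝ) (p : ℍ) (v : ℂ) (hp : p ∈ verticalLine a) :
    v.re = p.im * lor (2 * a, 1, 0) (hypDeriv p v) := by
  have := p.im_pos.ne'
  simp only [verticalLine, Set.mem_ofPred_eq] at hp
  simp only [lor, hypDeriv, UpperHalfPlane.coe_re, UpperHalfPlane.coe_im]
  field_simp
  rw [hp]; ring

lemma lor_hypDeriv_circle (c : ℝ) {r : ℝ} (hr : 0 < r) (p : ℍ) (v : ℂ) (hp : p ∈ halfCircle c r) :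
    inner ℝ ((p : ℂ) - (c : ℂ)) v = -(p.im * r) *
      lor ((c ^ 2 - r ^ 2) / r, c / r, 1 / r) (hypDeriv p v) := by
  have := p.im_pos.ne'
  simp only [halfCircle, Set.mem_ofPred_eq] at hp
  rw [Complex.inner]
  simp only [lor, hypDeriv, UpperHalfPlane.coe_re, UpperHalfPlane.coe_im, Complex.mul_re,
    Complex.conj_re, Complex.conj_im, Complex.sub_re, Complex.sub_im, Complex.ofReal_re,
    Complex.ofReal_im]
  field_simp
  linear_combination v.im * hp

lemma IsTangentVector.exists_line {L : Set ℍ} {p : ℍ} {v : ℂ} (h : IsTangentVector L p v) :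
    v ≠ 0 ∧ ∃ n, lor n n = 1 ∧ L = line n ∧ lor n (hyp p) = 0 ∧ lor n (hypDeriv p v) = 0 := by
  obtain ⟨hp, hv, ⟨a, rfl, h⟩ | ⟨c, r, hr, rfl, h⟩⟩ := h
  · refine ⟨hv, _, lor_vertical a, verticalLine_eq_line a, ?_, ?_⟩
    · rwa [verticalLine_eq_line] at hp
    · rw [lor_hypDeriv_vertical a p v hp] at h
      exact (mul_eq_zero.1 h).resolve_left p.im_pos.ne'
  · refine ⟨hv, _, lor_circle c hr, halfCircle_eq_line c hr, ?_, ?_⟩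
    · rwa [halfCircle_eq_line c hr] at hp
    · rw [lor_hypDeriv_circle c hr p v hp] at h
      exact (mul_eq_zero.1 h).resolve_left (by have := p.im_pos; have := mul_pos this hr; linarith)

lemma isTangentVector_line {n : ℝ × ℝ × ℝ} (hn : lor n n = 1) {p : ℍ} {v : ℂ} (hv : v ≠ 0)
    (hp : lor n (hyp p) = 0) (h : lor n (hypDeriv p v) = 0) : IsTangentVector (line n) p v := by
  refine ⟨hp, hv, ?_⟩
  rcases line_cases hn with ⟨a, h0⟩ | ⟨c, r, hr, h0⟩
  · have h1 : line n = verticalLine a := by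
      rcases h0 with rfl | rfl
      · rw [verticalLine_eq_line]
      · rw [line_neg, verticalLine_eq_line]
    refine Or.inl ⟨a, h1, ?_⟩
    rw [lor_hypDeriv_vertical a p v (by rw [← h1]; exact hp)]
    rcases h0 with rfl | rfl
    · rw [h, mul_zero]
    · rw [lor_neg_left, neg_eq_zero] at h
      rw [h, mul_zero]
  · have h1 : line n = halfCircle c r := by
      rcases h0 with rfl | rfl
      · rw [halfCircle_eq_line c hr]
      · rw [line_neg, halfCircle_eq_line c hr]
    refine Or.inr ⟨c, r, hr, h1, ?_⟩
    rw [lor_hypDeriv_circle c hr p v (by rw [← h1]; exact hp)]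
    rcases h0 with rfl | rfl
    · rw [h, mul_zero]
    · rw [lor_neg_left, neg_eq_zero] at h
      rw [h, mul_zero]

lemma PerpAt.exists_line {L M : Set ℍ} {p : ℍ} (h : PerpAt L M p) :
    ∃ n m, lor n n = 1 ∧ lor m m = 1 ∧ L = line n ∧ M = line m ∧ lor n (hyp p) = 0 ∧
      lor m (hyp p) = 0 ∧ lor n m = 0 := by
  obtain ⟨u, v, hu, hv, huv⟩ := h
  obtain ⟨hu0, n, hn, hL, hnp, hnu⟩ := hu.exists_line
  obtain ⟨hv0, m, hm, hM, hmp, hmv⟩ := hv.exists_line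
  refine ⟨n, m, hn, hm, hL, hM, hnp, hmp, ?_⟩
  -- both `m` and the velocity `u` are orthogonal to `v`, so `u` is a multiple of `m`
  have h3 : lor (hypDeriv p v) (hypDeriv p u) = 0 := by
    rw [lor_hypDeriv, real_inner_comm, huv, zero_div]
  have h4 := eq_smul_of_lor_eq_zero p (lor_hypDeriv_hyp p v) hmp (lor_hypDeriv_hyp p u)
    (hypDeriv_ne_zero p hv0) hm
    (by rw [lor_comm]; exact hmv) h3
  rw [h4, lor_smul_right] at hnu
  refine (mul_eq_zero.1 hnu).resolve_left fun h5 => ?_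
  rw [h5, zero_smul] at h4
  exact hypDeriv_ne_zero p hu0 h4

lemma perpAt_line {n m : ℝ × ℝ × ℝ} (hn : lor n n = 1) (hm : lor m m = 1) {p : ℍ}
    (hnp : lor n (hyp p) = 0) (hmp : lor m (hyp p) = 0) (h : lor n m = 0) :
    PerpAt (line n) (line m) p := by
  obtain ⟨ν, rfl⟩ := exists_hypDeriv p n hnp
  obtain ⟨μ, rfl⟩ := exists_hypDeriv p m hmp
  have h0 : ∀ v : ℂ, lor (hypDeriv p v) (hypDeriv p v) = 1 → v ≠ 0 := by
    rintro v hv rfl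
    simp [lor_hypDeriv] at hv
  -- `m` is tangent to `line n` and `n` is tangent to `line m`
  refine ⟨μ, ν, isTangentVector_line hn (h0 _ hm) hnp h,
    isTangentVector_line hm (h0 _ hn) hmp (by rw [lor_comm]; exact h), ?_⟩
  rw [lor_comm, lor_hypDeriv, div_eq_zero_iff] at h
  exact h.resolve_right (pow_ne_zero _ p.im_pos.ne')

lemma ne_zero_of_lor_self {k : ℝ × ℝ × ℝ} (hk : lor k k = 1) : k ≠ 0 := by
  rintro rfl
  simp [lor] at hk

lemma eq_or_eq_neg_of_lor_eq_zero (z : ℍ) {k n m : ℝ × ℝ × ℝ} (hkz : lor k (hyp z) = 0)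
    (hnz : lor n (hyp z) = 0) (hmz : lor m (hyp z) = 0) (hk : k ≠ 0) (hn : lor n n = 1)
    (hm : lor m m = 1) (hkn : lor k n = 0) (hkm : lor k m = 0) : m = n ∨ m = -n := by
  have h3 := eq_smul_of_lor_eq_zero z hkz hnz hmz hk hn hkn hkm
  have h4 : lor m n * lor m n = 1 := by
    nth_rewrite 1 [h3] at hm
    rw [lor_smul_left, lor_comm n m] at hm
    exact hm
  rcases mul_self_eq_one_iff.1 h4 with h5 | h5
  · left; rw [h3, h5, one_smul]
  · right; rw [h3, h5, neg_smul, one_smul]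

lemma line_injective {n m : ℝ × ℝ × ℝ} (hn : lor n n = 1) (hm : lor m m = 1) {p : ℍ}
    (hp : p ∈ line n) (h : line n = line m) : m = n ∨ m = -n := by
  have hmp : lor m (hyp p) = 0 := by rw [h] at hp; exact hp
  obtain ⟨k, hk, hkp, hkn⟩ := exists_orthogonal p hp hn
  obtain ⟨c, -, hc⟩ := exists_geodesic p hk hkp
  have h1 : c 1 ∈ line n := by
    change lor n (hyp (c 1)) = 0
    rw [hc, lor_add_right, lor_smul_right, lor_smul_right, lor_comm n k, hkn,
      show lor n (hyp p) = 0 from hp]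
    ring
  rw [h] at h1
  change lor m (hyp (c 1)) = 0 at h1
  rw [hc, lor_add_right, lor_smul_right, lor_smul_right, hmp, mul_zero, zero_add] at h1
  have h2 := (mul_eq_zero.1 h1).resolve_left (Real.sinh_pos_iff.2 one_pos).ne'
  exact eq_or_eq_neg_of_lor_eq_zero p hkp hp hmp (ne_zero_of_lor_self hk) hn hm hkn
    (by rw [lor_comm]; exact h2)

/-! ### Convexity and support normals -/

lemma mem_geodesicSegment {p q z : ℍ} {α β : ℝ} (hα : 0 ≤ α) (hβ : 0 ≤ β)
    (hz : hyp z = α • hyp p + β • hyp q) : z ∈ geodesicSegment p q := by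
  have h1 : Real.cosh (dist p z) = α + β * Real.cosh (dist p q) := by
    rw [← neg_inj, ← lor_hyp, hz, lor_add_right, lor_smul_right, lor_smul_right, lor_hyp_self,
      lor_hyp]
    ring
  have h2 : Real.cosh (dist z q) = α * Real.cosh (dist p q) + β := by
    rw [← neg_inj, ← lor_hyp, hz, lor_add_left, lor_smul_left, lor_smul_left, lor_hyp_self,
      lor_hyp]
    ring
  have h3 : α ^ 2 + β ^ 2 + 2 * α * β * Real.cosh (dist p q) = 1 := by
    have := lor_hyp_self z
    rw [hz] at this
    simp only [lor_add_left, lor_add_right, lor_smul_left, lor_smul_right, lor_hyp_self, lor_hyp,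
      dist_comm q p] at this
    linear_combination -this
  have hs : 0 ≤ Real.sinh (dist p q) := Real.sinh_nonneg_iff.2 dist_nonneg
  have hsq := Real.cosh_sq_sub_sinh_sq (dist p q)
  have h4 : Real.sinh (dist p z) = β * Real.sinh (dist p q) := by
    have hs' : 0 ≤ Real.sinh (dist p z) := Real.sinh_nonneg_iff.2 dist_nonneg
    have hsq' := Real.cosh_sq_sub_sinh_sq (dist p z)
    refine (sq_eq_sq₀ hs' (by positivity)).1 ?_
    rw [h1] at hsq'
    linear_combination -hsq' + h3 + β ^ 2 * hsq
  have h5 : Real.sinh (dist z q) = α * Real.sinh (dist p q) := by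
    have hs' : 0 ≤ Real.sinh (dist z q) := Real.sinh_nonneg_iff.2 dist_nonneg
    have hsq' := Real.cosh_sq_sub_sinh_sq (dist z q)
    refine (sq_eq_sq₀ hs' (by positivity)).1 ?_
    rw [h2] at hsq'
    linear_combination -hsq' + h3 + α ^ 2 * hsq
  have h6 : Real.cosh (dist p z + dist z q) = Real.cosh (dist p q) := by
    rw [Real.cosh_add, h1, h2, h4, h5]
    linear_combination Real.cosh (dist p q) * h3 - α * β * hsq
  exact eq_of_cosh_eq (by positivity) dist_nonneg h6

/-- A point of the segment from an interior point to a point of a convex set is an interior point,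
unless it is the second endpoint. -/
lemma mem_interior_of_eq_add {K : Set ℍ} (hK : ∀ x ∈ K, ∀ y ∈ K, geodesicSegment x y ⊆ K)
    {p q z : ℍ} (hp : p ∈ interior K) (hq : q ∈ K) {α β : ℝ} (hα : 0 < α) (hβ : 0 ≤ β)
    (hz : hyp z = α • hyp p + β • hyp q) : z ∈ interior K := by
  obtain ⟨ε, hε, hball⟩ := Metric.mem_nhds_iff.1 (mem_interior_iff_mem_nhds.1 hp)
  -- a point `z'` near `z` lies on a segment from a point `p'` near `p` to `q`; the vector of `p'`
  -- is proportional to `hyp z' - β • hyp q`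
  set f : ℍ → ℝ := fun z' => 1 + 2 * β * lor (hyp q) (hyp z') + β ^ 2 with hf
  set g : ℍ → ℝ := fun z' => β * lor (hyp q) (hyp p) - lor (hyp p) (hyp z') with hg
  have hfc : Continuous f := by
    have := continuous_lor_hyp (hyp q)
    fun_prop
  have hgc : Continuous g := by
    have := continuous_lor_hyp (hyp p)
    fun_prop
  have hfz : f z = α ^ 2 := by
    have := lor_hyp_self z
    rw [hz] at this
    simp only [lor_add_left, lor_add_right, lor_smul_left, lor_smul_right, lor_hyp_self,
      lor_comm (hyp q) (hyp p)] at this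
    simp only [hf, hz, lor_add_right, lor_smul_right, lor_hyp_self, lor_comm (hyp q) (hyp p)]
    linear_combination this
  have hgz : g z = α := by
    simp only [hg, hz, lor_add_right, lor_smul_right, lor_hyp_self, lor_comm (hyp q) (hyp p)]
    ring
  have e1 : ∀ᶠ z' in nhds z, 0 < f z' :=
    continuousAt_const.eventually_lt hfc.continuousAt (by rw [hfz]; positivity)
  have e2 : ∀ᶠ z' in nhds z, 0 < g z' :=
    continuousAt_const.eventually_lt hgc.continuousAt (by rw [hgz]; positivity)
  have e3 : ∀ᶠ z' in nhds z, g z' < Real.cosh ε * √(f z') := by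
    refine hgc.continuousAt.eventually_lt
      (continuousAt_const.mul hfc.continuousAt.sqrt) ?_
    rw [hfz, hgz, Real.sqrt_sq hα.le]
    have := Real.one_lt_cosh.2 hε.ne'
    nlinarith
  rw [mem_interior_iff_mem_nhds]
  filter_upwards [e1, e2, e3] with z' h1 h2 h3
  have hN : 0 < √(f z') := Real.sqrt_pos.2 h1
  have hNN : √(f z') * √(f z') = f z' := Real.mul_self_sqrt h1.le
  have hvp : lor (hyp z' - β • hyp q) (hyp p) = -g z' := by
    simp only [hg, lor_sub_left, lor_smul_left, lor_comm (hyp z') (hyp p)]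
    ring
  obtain ⟨p', hp'⟩ := exists_hyp_eq p (v := (√(f z'))⁻¹ • (hyp z' - β • hyp q))
    (by
      rw [lor_smul_left, lor_smul_right]
      have : lor (hyp z' - β • hyp q) (hyp z' - β • hyp q) = -f z' := by
        simp only [hf, lor_sub_left, lor_sub_right, lor_smul_left, lor_smul_right, lor_hyp_self,
          lor_comm (hyp z') (hyp q)]
        ring
      rw [this]
      field_simp
      rw [Real.sq_sqrt h1.le])
    (by
      rw [lor_smul_left, hvp]
      have : 0 < (√(f z'))⁻¹ := by positivity
      nlinarith)
  have hp'K : p' ∈ K := by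
    apply hball
    have h4 : Real.cosh (dist p' p) = (√(f z'))⁻¹ * g z' := by
      rw [← neg_inj, ← lor_hyp, hp', lor_smul_left, hvp]
      ring
    have h5 : Real.cosh (dist p' p) < Real.cosh ε := by
      rw [h4, inv_mul_lt_iff₀ hN]
      linarith
    rw [Real.cosh_lt_cosh, abs_of_nonneg dist_nonneg, abs_of_pos hε] at h5
    exact h5
  refine hK p' hp'K q hq (mem_geodesicSegment hN.le hβ ?_)
  rw [hp', smul_smul, mul_inv_cancel₀ hN.ne', one_smul]
  abel

/-- `n` is the outward unit normal of a supporting geodesic of `K`. -/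
def IsSupportNormal (K : Set ℍ) (n : ℝ × ℝ × ℝ) : Prop :=
  lor n n = 1 ∧ (∀ z ∈ K, lor n (hyp z) ≤ 0) ∧ ∃ z ∈ K, lor n (hyp z) = 0

lemma IsSupporting.exists_isSupportNormal {K L : Set ℍ} (hK : IsConvexBody K)
    (h : IsSupporting K L) : ∃ n, IsSupportNormal K n ∧ L = line n := by
  obtain ⟨hL, ⟨x, hxL, hxK⟩, hdisj⟩ := h
  obtain ⟨n, hn, rfl⟩ := hL.exists_line
  have hno : ∀ p ∈ interior K, ∀ q ∈ interior K, ¬ (lor n (hyp p) < 0 ∧ 0 < lor n (hyp q)) := by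
    rintro p hp q hq ⟨h1, h2⟩
    -- the segment from `p` to `q` would meet the line in an interior point
    set a := lor n (hyp q)
    set b := -lor n (hyp p) with hb
    have hb0 : 0 < b := by linarith
    set N := a ^ 2 + b ^ 2 - 2 * a * b * lor (hyp p) (hyp q) with hN
    have hpq := lor_hyp_le p q
    have hN0 : 0 < N := by nlinarith [mul_pos h2 hb0, sq_nonneg a, sq_nonneg b]
    have hs : 0 < √N := Real.sqrt_pos.2 hN0
    have hss : √N * √N = N := Real.mul_self_sqrt hN0.le
    obtain ⟨z, hz⟩ := exists_hyp_eq p (v := (a / √N) • hyp p + (b / √N) • hyp q)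
      (by
        simp only [lor_add_left, lor_add_right, lor_smul_left, lor_smul_right, lor_hyp_self,
          lor_comm (hyp q) (hyp p)]
        field_simp
        rw [sq (√N), hss, hN]
        ring)
      (by
        simp only [lor_add_left, lor_smul_left, lor_hyp_self, lor_comm (hyp q) (hyp p)]
        have h3 : 0 < a / √N := by positivity
        have h4 : 0 < b / √N := by positivity
        nlinarith)
    have hzi : z ∈ interior K :=
      mem_interior_of_eq_add hK.convex hp (interior_subset hq) (by positivity) (by positivity) hz
    refine Set.disjoint_left.1 hdisj (?_ : lor n (hyp z) = 0) hzi
    rw [hz, lor_add_right, lor_smul_right, lor_smul_right,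
      show lor n (hyp p) = -b by rw [hb, neg_neg]]
    change a / √N * -b + b / √N * a = 0
    ring
  have hne : ∀ p ∈ interior K, lor n (hyp p) ≠ 0 := fun p hp h0 =>
    Set.disjoint_left.1 hdisj h0 hp
  obtain ⟨p, hp⟩ := hK.interior_nonempty
  rcases lt_or_gt_of_ne (hne p hp) with h1 | h1
  · refine ⟨n, ⟨hn, ?_, x, hxK, hxL⟩, rfl⟩
    have hcl : IsClosed {z : ℍ | lor n (hyp z) ≤ 0} :=
      isClosed_le (continuous_lor_hyp n) continuous_const
    rw [← hK.closure_interior]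
    exact fun z hz => closure_minimal (fun q hq => not_lt.1 fun h2 => hno p hp q hq ⟨h1, h2⟩) hcl hz
  · refine ⟨-n, ⟨by rw [lor_neg_left, lor_neg_right, hn, neg_neg], ?_, x, hxK, ?_⟩,
      (line_neg n).symm⟩
    · have hcl : IsClosed {z : ℍ | lor (-n) (hyp z) ≤ 0} :=
        isClosed_le (continuous_lor_hyp (-n)) continuous_const
      rw [← hK.closure_interior]
      refine fun z hz => closure_minimal (fun q hq => ?_) hcl hz
      have := hno q hq p hp
      simp only [lor_neg_left, Set.mem_ofPred_eq]
      by_contra! h2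
      exact this ⟨by linarith, h1⟩
    · rw [lor_neg_left, show lor n (hyp x) = 0 from hxL, neg_zero]

lemma IsSupportNormal.lt_zero {K : Set ℍ} {n : ℝ × ℝ × ℝ} (hn : IsSupportNormal K n) {z : ℍ}
    (hz : z ∈ interior K) : lor n (hyp z) < 0 := by
  refine lt_of_le_of_ne (hn.2.1 z (interior_subset hz)) fun h0 => ?_
  obtain ⟨ε, hε, hball⟩ := Metric.mem_nhds_iff.1 (mem_interior_iff_mem_nhds.1 hz)
  -- moving from `z` in the direction `n` stays in `K` and makes `lor n` positive
  obtain ⟨c, hc, h⟩ := exists_geodesic z hn.1 h0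
  have hc0 : c 0 = z := hyp_injective (by simp [h])
  have h1 : c (ε / 2) ∈ K := by
    apply hball
    rw [Metric.mem_ball]
    nth_rewrite 1 [← hc0]
    rw [hc.dist_eq, Real.dist_eq, sub_zero, abs_of_pos (by positivity)]
    linarith
  have h2 := hn.2.1 _ h1
  rw [h, lor_add_right, lor_smul_right, lor_smul_right, h0, hn.1] at h2
  have := Real.sinh_pos_iff.2 (half_pos hε)
  linarith

lemma IsSupportNormal.mem_frontier {K : Set ℍ} {n : ℝ × ℝ × ℝ} (hn : IsSupportNormal K n) {z : ℍ}
    (hz : z ∈ K) (h : lor n (hyp z) = 0) : z ∈ frontier K :=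
  ⟨subset_closure hz, fun hi => (hn.lt_zero hi).ne h⟩

/-! ### Smoothness of the boundary -/

lemma hasDerivAt_lor_hyp (n : ℝ × ℝ × ℝ) {γ : ℝ → ℂ} {g : ℂ} {t : ℝ} (h : HasDerivAt γ g t)
    (him : (γ t).im ≠ 0) :
    HasDerivAt (fun s => lor n (hyp (γ s))) (lor n (hypDeriv (γ t) g)) t := by
  have hre : HasDerivAt (fun s => (γ s).re) g.re t :=
    Complex.reCLM.hasFDerivAt.comp_hasDerivAt t h
  have hi : HasDerivAt (fun s => (γ s).im) g.im t :=
    Complex.imCLM.hasFDerivAt.comp_hasDerivAt t h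
  have h1 := (((hre.pow 2).add (hi.pow 2)).div hi him)
  have h2 := hre.div hi him
  have h3 := (hasDerivAt_const t (1 : ℝ)).div hi him
  have h4 := (h2.const_mul n.2.1).sub (((h3.const_mul n.1).add (h1.const_mul n.2.2)).div_const 2)
  refine h4.congr_deriv ?_
  simp only [lor, hypDeriv]
  field_simp
  simp
  ring

lemma lor_hypDeriv_eq_zero {K : Set ℍ} {n : ℝ × ℝ × ℝ} (hn : IsSupportNormal K n) {γ : ℝ → ℂ}
    {g : ℂ} {t : ℝ} {x : ℍ} (hγ : HasDerivAt γ g t) (hx : γ t = x) (hnx : lor n (hyp x) = 0)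
    (hK : ∀ s, ∃ z ∈ K, γ s = z) : lor n (hypDeriv x g) = 0 := by
  have h1 := hasDerivAt_lor_hyp n hγ (by rw [hx]; exact x.im_pos.ne')
  rw [hx] at h1
  refine IsLocalMax.hasDerivAt_eq_zero (Filter.Eventually.of_forall fun s => ?_) h1
  obtain ⟨z, hz, hs⟩ := hK s
  simp only [hs, hx, hnx]
  exact hn.2.1 z hz

/-- Through a boundary point of a body with `C¹` boundary there is only one supporting geodesic:
both are tangent to the boundary curve. -/
lemma IsSupportNormal.eq_of_isC1 {K : Set ℍ} (hK : IsConvexBody K)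
    (hC1 : IsC1ClosedCurve (frontier K)) {n m : ℝ × ℝ × ℝ} (hn : IsSupportNormal K n)
    (hm : IsSupportNormal K m) {x : ℍ} (hx : x ∈ frontier K) (hnx : lor n (hyp x) = 0)
    (hmx : lor m (hyp x) = 0) : m = n := by
  obtain ⟨γ, hγ, hγ', -, -, hr⟩ := hC1
  have hγK : ∀ s, ∃ z ∈ K, γ s = z := by
    intro s
    obtain ⟨z, hz, h⟩ := hr.subset (Set.mem_range_self s)
    exact ⟨z, hK.isCompact.isClosed.frontier_subset hz, h.symm⟩
  obtain ⟨t, ht⟩ := hr.superset (Set.mem_image_of_mem _ hx)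
  have hd : HasDerivAt γ (deriv γ t) t := (hγ.differentiable one_ne_zero t).hasDerivAt
  have h0 : hypDeriv x (deriv γ t) ≠ 0 := hypDeriv_ne_zero x (hγ' t)
  rcases eq_or_eq_neg_of_lor_eq_zero x (lor_hypDeriv_hyp x _) hnx hmx h0 hn.1 hm.1
    (by rw [lor_comm]; exact lor_hypDeriv_eq_zero hn hd ht hnx hγK)
    (by rw [lor_comm]; exact lor_hypDeriv_eq_zero hm hd ht hmx hγK) with h | h
  · exact h
  · obtain ⟨p, hp⟩ := hK.interior_nonempty
    have h1 := hn.lt_zero hp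
    have h2 := hm.lt_zero hp
    rw [h, lor_neg_left] at h2
    linarith

/-! ### Constant width -/

/-- In the plane spanned by `hyp x` and `n`, a support normal `m` other than `±n` is determined by
the distance `dist x y` from `x` to the foot `y` of its line on the geodesic in direction `n`. -/
lemma IsSupportNormal.opposite_eq {K : Set ℍ} {n m k : ℝ × ℝ × ℝ} {x y : ℍ}
    (hn : IsSupportNormal K n) (hm : IsSupportNormal K m) (hx : x ∈ K) (hnx : lor n (hyp x) = 0)
    (hk : lor k k = 1) (hkx : lor k (hyp x) = 0) (hkn : lor k n = 0) (hkm : lor k m = 0)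
    (hky : lor k (hyp y) = 0) (hmy : lor m (hyp y) = 0) (hne : line m ≠ line n) :
    0 < dist x y ∧
      m = Real.sinh (dist x y) • hyp x - Real.cosh (dist x y) • n := by
  have hk0 := ne_zero_of_lor_self hk
  have hm' := eq_smul_hyp_add_smul x hkx hnx hk0 hn.1 hkn hkm
  have hy' := eq_smul_hyp_add_smul x hkx hnx hk0 hn.1 hkn hky
  have ha : 0 ≤ -lor m (hyp x) := by linarith [hm.2.1 x hx]
  have hd : -lor (hyp y) (hyp x) = Real.cosh (dist x y) := by rw [lor_hyp, neg_neg, dist_comm]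
  rw [hd] at hy'
  generalize -lor m (hyp x) = a at hm' ha
  generalize lor m n = b at hm'
  generalize lor (hyp y) n = d at hy'
  have hsq := Real.cosh_sq_sub_sinh_sq (dist x y)
  have hs : 0 ≤ Real.sinh (dist x y) := Real.sinh_nonneg_iff.2 dist_nonneg
  have hxn := hnx
  rw [lor_comm] at hxn
  have h1 : b ^ 2 - a ^ 2 = 1 := by
    have := hm.1
    rw [hm'] at this
    simp only [lor_add_left, lor_add_right, lor_smul_left, lor_smul_right, lor_hyp_self, hnx, hxn,
      hn.1] at this
    linear_combination this
  have h2 : d ^ 2 = Real.sinh (dist x y) ^ 2 := by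
    have := lor_hyp_self y
    rw [hy'] at this
    simp only [lor_add_left, lor_add_right, lor_smul_left, lor_smul_right, lor_hyp_self, hnx, hxn,
      hn.1] at this
    linear_combination this + hsq
  have h3 : a * Real.cosh (dist x y) = b * d := by
    rw [hm', hy'] at hmy
    simp only [lor_add_left, lor_add_right, lor_smul_left, lor_smul_right, lor_hyp_self, hnx, hxn,
      hn.1] at hmy
    linear_combination -hmy
  have ha0 : 0 < a := by
    refine lt_of_le_of_ne ha ?_
    rintro rfl
    apply hne
    rcases mul_self_eq_one_iff.1 (show b * b = 1 by linear_combination h1) with rfl | rfl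
    · rw [hm', zero_smul, zero_add, one_smul]
    · rw [hm', zero_smul, zero_add, neg_smul, one_smul, line_neg]
  have hb0 : b < 0 := by
    obtain ⟨ζ, hζ, h0⟩ := hm.2.2
    rw [hm', lor_add_left, lor_smul_left, lor_smul_left] at h0
    have h4 := lor_hyp_le x ζ
    have h5 := hn.2.1 ζ hζ
    by_contra! hb
    nlinarith
  have has : a = Real.sinh (dist x y) := by
    refine (sq_eq_sq₀ ha hs).1 ?_
    have h4 : (a * Real.cosh (dist x y)) ^ 2 = (b * d) ^ 2 := by rw [h3]
    rw [mul_pow, mul_pow, h2] at h4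
    linear_combination h4 - a ^ 2 * hsq + Real.sinh (dist x y) ^ 2 * h1
  have hbc : -b = Real.cosh (dist x y) := by
    refine (sq_eq_sq₀ (by linarith) (Real.cosh_pos _).le).1 ?_
    rw [has] at h1
    linear_combination h1 - hsq
  refine ⟨Real.sinh_pos_iff.1 (has ▸ ha0), ?_⟩
  rw [hm', ← has, ← hbc, neg_smul, sub_neg_eq_add]

/-- For a body of constant width with `C¹` boundary, the geodesic at distance `w` from a supporting
geodesic, measured along the normal at the contact point, is again supporting. -/
lemma HasConstantWidth.opposite {K : Set ℍ} {w : ℝ} (hK : IsConvexBody K)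
    (hC1 : IsC1ClosedCurve (frontier K)) (hw : HasConstantWidth K w) {n : ℝ × ℝ × ℝ}
    (hn : IsSupportNormal K n) {x : ℍ} (hx : x ∈ K) (hnx : lor n (hyp x) = 0) :
    0 < w ∧ IsSupportNormal K (Real.sinh w • hyp x - Real.cosh w • n) := by
  have hxf := hn.mem_frontier hx hnx
  obtain ⟨G₁, N, G₂, y, ⟨-, hG₁, hperp₁⟩, hG₂, hne, hperp₂, rfl⟩ := hw x hxf
  obtain ⟨n₁, hn₁, rfl⟩ := hG₁.exists_isSupportNormal hK
  obtain ⟨m, hm, rfl⟩ := hG₂.exists_isSupportNormal hK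
  obtain ⟨n₂, k, hn₂, hk, h₁, rfl, hn₂x, hkx, hn₂k⟩ := hperp₁.exists_line
  obtain ⟨m₂, k₂, hm₂, hk₂, h₂, h₃, hm₂y, hk₂y, hm₂k₂⟩ := hperp₂.exists_line
  have hxn₁ : lor n₁ (hyp x) = 0 := by
    have : x ∈ line n₂ := hn₂x
    rwa [← h₁] at this
  obtain rfl := hn.eq_of_isC1 hK hC1 hn₁ hxf hnx hxn₁
  have hkn : lor k n₁ = 0 := by
    rw [lor_comm]
    rcases line_injective hn.1 hn₂ hxn₁ h₁ with rfl | rfl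
    · exact hn₂k
    · rwa [lor_neg_left, neg_eq_zero] at hn₂k
  have hky : lor k (hyp y) = 0 := by
    have : y ∈ line k₂ := hk₂y
    rwa [← h₃] at this
  have hmy : lor m (hyp y) = 0 := by
    have : y ∈ line m₂ := hm₂y
    rwa [← h₂] at this
  have hkm : lor k m = 0 := by
    rw [lor_comm]
    have h4 : lor m k₂ = 0 := by
      rcases line_injective hm.1 hm₂ hmy h₂ with rfl | rfl
      · exact hm₂k₂
      · rwa [lor_neg_left, neg_eq_zero] at hm₂k₂
    rcases line_injective hk hk₂ hkx h₃ with rfl | rfl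
    · exact h4
    · rwa [lor_neg_right, neg_eq_zero] at h4
  obtain ⟨hpos, rfl⟩ := hn.opposite_eq hm hx hnx hk hkx hkn hkm hky hmy hne
  exact ⟨hpos, hm⟩

/-- No point of a body of constant width `w` is farther than `w` from a supporting geodesic: at a
farthest point the normal is perpendicular to the supporting geodesic. -/
lemma HasConstantWidth.neg_lor_le {K : Set ℍ} {w : ℝ} (hK : IsConvexBody K)
    (hC1 : IsC1ClosedCurve (frontier K)) (hw : HasConstantWidth K w) {n : ℝ × ℝ × ℝ}
    (hn : IsSupportNormal K n) {ζ : ℍ} (hζ : ζ ∈ K) : -lor n (hyp ζ) ≤ Real.sinh w := by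
  obtain ⟨p, hp⟩ := hK.interior_nonempty
  obtain ⟨z, hz, hmax⟩ := hK.isCompact.exists_isMinOn ⟨p, interior_subset hp⟩
    (continuous_lor_hyp n).continuousOn
  have hmax' : ∀ ζ ∈ K, lor n (hyp z) ≤ lor n (hyp ζ) := fun ζ h => hmax h
  set D := Real.arsinh (-lor n (hyp z)) with hD
  have hsD : Real.sinh D = -lor n (hyp z) := Real.sinh_arsinh _
  have hD0 : 0 < Real.sinh D := by
    rw [hsD]
    linarith [hn.lt_zero hp, hmax' p (interior_subset hp)]
  have hcD := Real.cosh_pos D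
  have hsq := Real.cosh_sq_sub_sinh_sq D
  have hnz : lor n (hyp z) = -Real.sinh D := by rw [hsD, neg_neg]
  -- the normal at `z` to the curve of points at distance `D` from `line n`
  have hmζ : ∀ ζ : ℍ, lor ((Real.cosh D)⁻¹ • (Real.sinh D • hyp z - n)) (hyp ζ) =
      (Real.cosh D)⁻¹ * (Real.sinh D * lor (hyp z) (hyp ζ) - lor n (hyp ζ)) := by
    intro ζ
    rw [lor_smul_left, lor_sub_left, lor_smul_left]
  have hmz : lor ((Real.cosh D)⁻¹ • (Real.sinh D • hyp z - n)) (hyp z) = 0 := by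
    rw [hmζ, lor_hyp_self, hnz]
    ring
  have hm : IsSupportNormal K ((Real.cosh D)⁻¹ • (Real.sinh D • hyp z - n)) := by
    refine ⟨?_, fun ζ hζ => ?_, z, hz, hmz⟩
    · simp only [lor_smul_left, lor_smul_right, lor_sub_left, lor_sub_right, lor_hyp_self, hn.1,
        lor_comm (hyp z) n, hnz]
      field_simp
      linear_combination -hsq
    · rw [hmζ]
      refine mul_nonpos_of_nonneg_of_nonpos (by positivity) ?_
      have h1 := lor_hyp_le z ζ
      have h2 := hmax' ζ hζ
      nlinarith
  obtain ⟨-, hm₂⟩ := hw.opposite hK hC1 hm hz hmz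
  -- `line n` touches `K`, so it cannot lie beyond the opposite supporting geodesic
  obtain ⟨ξ, hξ, hnξ⟩ := hn.2.2
  have h3 := hm₂.2.1 ξ hξ
  rw [lor_sub_left, lor_smul_left, lor_smul_left, hmζ, hnξ] at h3
  have h4 := lor_hyp_le z ξ
  have h5 : 0 ≤ Real.sinh (w - D) := by
    rw [Real.sinh_sub]
    have h6 :
        (Real.sinh w * Real.cosh D - Real.cosh w * Real.sinh D) * lor (hyp z) (hyp ξ) ≤ 0 := by
      have h7 := mul_nonpos_of_nonneg_of_nonpos hcD.le h3
      have h8 : (Real.sinh w * Real.cosh D - Real.cosh w * Real.sinh D) * lor (hyp z) (hyp ξ) =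
        Real.cosh D * (Real.sinh w * lor (hyp z) (hyp ξ) -
          Real.cosh w * ((Real.cosh D)⁻¹ * (Real.sinh D * lor (hyp z) (hyp ξ) - 0))) := by
        field_simp
        ring
      rw [h8]
      exact h7
    by_contra! h9
    nlinarith
  have h6 : Real.sinh D ≤ Real.sinh w := by
    rw [Real.sinh_le_sinh]
    linarith [Real.sinh_nonneg_iff.1 h5]
  linarith [hmax' ζ hζ]

/-! ### Projections -/

/-- The projection onto a geodesic perpendicular to two opposite supporting geodesics at distance
`t` has length `t`. -/
lemma projectionLength_eq {K : Set ℍ} {x : ℍ} {n k : ℝ × ℝ × ℝ} {t : ℝ} (ht : 0 ≤ t)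
    (hn : IsSupportNormal K n) (hnx : lor n (hyp x) = 0)
    (hm : IsSupportNormal K (Real.sinh t • hyp x - Real.cosh t • n))
    (hk : lor k k = 1) (hkx : lor k (hyp x) = 0) (hkn : lor k n = 0) :
    projectionLength (line k) K = t := by
  have hxn := hnx
  rw [lor_comm] at hxn
  -- the inward unit speed parametrization of `line k` from `x`
  obtain ⟨c, hc, hct⟩ := exists_geodesic x (e := -n)
    (by rw [lor_neg_left, lor_neg_right, hn.1, neg_neg]) (by rw [lor_neg_left, hnx, neg_zero])
  have hct' : ∀ τ, hyp (c τ) = Real.cosh τ • hyp x - Real.sinh τ • n := by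
    intro τ
    rw [hct, smul_neg, sub_eq_add_neg]
  have hmem : ∀ τ ζ, ζ ∈ K → Real.sinh τ * lor (hyp x) (hyp ζ) = Real.cosh τ * lor n (hyp ζ) →
      c τ ∈ projection (line k) K := by
    intro τ ζ hζ h
    have hsq := Real.cosh_sq_sub_sinh_sq τ
    have hkc : lor k (hyp (c τ)) = 0 := by
      rw [hct', lor_sub_right, lor_smul_right, lor_smul_right, hkx, hkn]
      ring
    refine ⟨hkc, line (Real.sinh τ • hyp x - Real.cosh τ • n),
      perpAt_line ?_ hk ?_ hkc ?_, ζ, hζ, ?_⟩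
    · simp only [lor_sub_left, lor_sub_right, lor_smul_left, lor_smul_right, lor_hyp_self, hn.1,
        hxn, hnx]
      linear_combination hsq
    · simp only [hct', lor_sub_left, lor_sub_right, lor_smul_left, lor_smul_right, lor_hyp_self,
        hn.1, hxn, hnx]
      ring
    · rw [lor_comm, lor_sub_right, lor_smul_right, lor_smul_right, hkx, hkn]
      ring
    · change lor _ _ = 0
      rw [lor_sub_left, lor_smul_left, lor_smul_left, h, sub_self]
  have hsub : ∀ P ∈ projection (line k) K, ∃ τ, 0 ≤ τ ∧ τ ≤ t ∧ c τ = P := by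
    rintro P ⟨hkP, N, hN, ζ, hζ, hζN⟩
    obtain ⟨m', k', hm', hk', rfl, hkk', hm'P, hk'P, hm'k'⟩ := hN.exists_line
    have hm'k : lor k m' = 0 := by
      rw [lor_comm]
      rcases line_injective hk hk' hkx hkk' with rfl | rfl
      · exact hm'k'
      · rwa [lor_neg_right, neg_eq_zero] at hm'k'
    have hk0 := ne_zero_of_lor_self hk
    have hP := eq_smul_hyp_add_smul x hkx hnx hk0 hn.1 hkn hkP
    have hm₁ := eq_smul_hyp_add_smul x hkx hnx hk0 hn.1 hkn hm'k
    have hα := lor_hyp_le P x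
    set τ := Real.arsinh (-lor (hyp P) n) with hτ
    have hsτ : lor (hyp P) n = -Real.sinh τ := by rw [hτ, Real.sinh_arsinh, neg_neg]
    have hcτ : -lor (hyp P) (hyp x) = Real.cosh τ := by
      refine (sq_eq_sq₀ (by linarith) (Real.cosh_pos _).le).1 ?_
      have h1 := lor_hyp_self P
      rw [hP] at h1
      simp only [lor_add_left, lor_add_right, lor_smul_left, lor_smul_right, lor_hyp_self, hn.1,
        hxn, hnx] at h1
      rw [hsτ] at h1
      linear_combination -h1 - Real.cosh_sq_sub_sinh_sq τ
    rw [hsτ, hcτ] at hP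
    have hcP : c τ = P := hyp_injective (by rw [hct', hP, neg_smul, sub_eq_add_neg])
    change lor m' (hyp ζ) = 0 at hζN
    generalize -lor m' (hyp x) = a at hm₁
    generalize lor m' n = b at hm₁
    have hab : b ^ 2 - a ^ 2 = 1 := by
      rw [hm₁] at hm'
      simp only [lor_add_left, lor_add_right, lor_smul_left, lor_smul_right, lor_hyp_self, hn.1,
        hxn, hnx] at hm'
      linear_combination hm'
    have hb0 : b ≠ 0 := by
      rintro rfl
      nlinarith [sq_nonneg a]
    have h2 : a * Real.cosh τ = -(b * Real.sinh τ) := by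
      rw [hm₁, hP] at hm'P
      simp only [lor_add_left, lor_add_right, lor_smul_left, lor_smul_right, lor_hyp_self, hn.1,
        hxn, hnx] at hm'P
      linear_combination -hm'P
    rw [hm₁, lor_add_left, lor_smul_left, lor_smul_left] at hζN
    have h3 : Real.sinh τ * lor (hyp x) (hyp ζ) = Real.cosh τ * lor n (hyp ζ) := by
      apply mul_left_cancel₀ hb0
      linear_combination -Real.cosh τ * hζN + lor (hyp x) (hyp ζ) * h2
    have h4 := hn.2.1 ζ hζ
    have h5 := hm.2.1 ζ hζ
    rw [lor_sub_left, lor_smul_left, lor_smul_left] at h5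
    have h6 := lor_hyp_le x ζ
    have hcpos := Real.cosh_pos τ
    refine ⟨τ, ?_, ?_, hcP⟩
    · rw [← Real.sinh_nonneg_iff]
      by_contra! h7
      nlinarith
    · have h8 : 0 ≤ Real.sinh (t - τ) := by
        rw [Real.sinh_sub]
        have h9 : (Real.sinh t * Real.cosh τ - Real.cosh t * Real.sinh τ) * lor (hyp x) (hyp ζ) ≤
            0 := by
          have := mul_nonpos_of_nonneg_of_nonpos hcpos.le h5
          linear_combination this - Real.cosh t * h3
        by_contra! h7
        nlinarith
      linarith [Real.sinh_nonneg_iff.1 h8]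
  have hdist : ∀ P ∈ projection (line k) K, ∀ Q ∈ projection (line k) K, dist P Q ≤ t := by
    intro P hP Q hQ
    obtain ⟨τ, h1, h2, rfl⟩ := hsub P hP
    obtain ⟨σ, h3, h4, rfl⟩ := hsub Q hQ
    rw [hc.dist_eq, Real.dist_eq, abs_le]
    constructor <;> linarith
  refine le_antisymm (Metric.diam_le_of_forall_dist_le ht hdist) ?_
  obtain ⟨ζ, hζ, h1⟩ := hn.2.2
  obtain ⟨ξ, hξ, h2⟩ := hm.2.2
  rw [lor_sub_left, lor_smul_left, lor_smul_left, sub_eq_zero] at h2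
  have h3 := Metric.dist_le_diam_of_mem
    (Metric.isBounded_iff.2 ⟨t, fun P hP Q hQ => hdist P hP Q hQ⟩)
    (hmem 0 ζ hζ (by rw [h1, Real.sinh_zero]; ring)) (hmem t ξ hξ h2)
  rwa [hc.dist_eq, Real.dist_eq, zero_sub, abs_neg, abs_of_nonneg ht] at h3

/-- The supporting geodesic opposite to `line n` among the perpendiculars to the geodesic through
`y` in direction `n`. -/
lemma exists_opposite {K : Set ℍ} (hK : IsCompact K) {n : ℝ × ℝ × ℝ} (hn : IsSupportNormal K n)
    {y : ℍ} (hny : lor n (hyp y) = 0) :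
    ∃ t, 0 ≤ t ∧ IsSupportNormal K (Real.sinh t • hyp y - Real.cosh t • n) := by
  have hneg : ∀ ζ : ℍ, lor (hyp y) (hyp ζ) < 0 := fun ζ => by linarith [lor_hyp_le y ζ]
  have hcont : Continuous fun ζ : ℍ => lor n (hyp ζ) / lor (hyp y) (hyp ζ) :=
    (continuous_lor_hyp n).div (continuous_lor_hyp (hyp y)) fun ζ => (hneg ζ).ne
  obtain ⟨ζ₀, hζ₀, -⟩ := hn.2.2
  obtain ⟨ζ, hζ, hmax⟩ := hK.exists_isMaxOn ⟨ζ₀, hζ₀⟩ hcont.continuousOn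
  have hmax' : ∀ ξ ∈ K, lor n (hyp ξ) / lor (hyp y) (hyp ξ) ≤
    lor n (hyp ζ) / lor (hyp y) (hyp ζ) := fun ξ h => hmax h
  set ρ := lor n (hyp ζ) / lor (hyp y) (hyp ζ) with hρ
  have hρ0 : 0 ≤ ρ := div_nonneg_of_nonpos (hn.2.1 ζ hζ) (hneg ζ).le
  have hρ1 : ρ < 1 := by
    rw [hρ, div_lt_one_of_neg (hneg ζ)]
    have h1 := lor_sq_le y (u := hyp ζ + lor (hyp ζ) (hyp y) • hyp y) (n := n)
      (by rw [lor_add_left, lor_smul_left, lor_hyp_self]; ring) hny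
    simp only [lor_add_left, lor_add_right, lor_smul_left, lor_smul_right, lor_hyp_self, hn.1,
      lor_comm (hyp y) n, hny, lor_comm (hyp ζ) (hyp y), lor_comm (hyp ζ) n] at h1
    have h2 := hn.2.1 ζ hζ
    have h3 := hneg ζ
    nlinarith
  clear_value ρ
  obtain ⟨t, rfl⟩ : ∃ t, Real.tanh t = ρ := ⟨_, Real.tanh_artanh ⟨by linarith, hρ1⟩⟩
  have hc := Real.cosh_pos t
  rw [Real.tanh_eq_sinh_div_cosh] at *
  have hnζ : lor n (hyp ζ) = Real.sinh t / Real.cosh t * lor (hyp y) (hyp ζ) := by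
    rw [hρ, div_mul_cancel₀ _ (hneg ζ).ne]
  refine ⟨t, ?_, ?_, fun ξ hξ => ?_, ζ, hζ, ?_⟩
  · rw [le_div_iff₀ hc, zero_mul] at hρ0
    exact Real.sinh_nonneg_iff.1 hρ0
  · simp only [lor_sub_left, lor_sub_right, lor_smul_left, lor_smul_right, lor_hyp_self, hn.1,
      lor_comm (hyp y) n, hny]
    linear_combination Real.cosh_sq_sub_sinh_sq t
  · have h1 := hmax' ξ hξ
    rw [div_le_iff_of_neg (hneg ξ), div_mul_eq_mul_div, div_le_iff₀ hc] at h1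
    rw [lor_sub_left, lor_smul_left, lor_smul_left]
    linarith
  · rw [lor_sub_left, lor_smul_left, lor_smul_left, hnζ]
    field_simp
    ring

/-! ### The disc -/

/-- At a point of `K` farthest from `o` the supporting geodesic is perpendicular to the geodesic
through `o`. -/
lemma exists_isSupportNormal_of_farthest {K : Set ℍ} {o x : ℍ} (hx : x ∈ K) (hne : o ≠ x)
    (hmax : ∀ z ∈ K, dist o z ≤ dist o x) :
    ∃ n, IsSupportNormal K n ∧ lor n (hyp x) = 0 ∧
      hyp o = Real.cosh (dist o x) • hyp x - Real.sinh (dist o x) • n := by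
  have hs : 0 < Real.sinh (dist o x) := Real.sinh_pos_iff.2 (dist_pos.2 hne)
  have hsq := Real.cosh_sq_sub_sinh_sq (dist o x)
  have hx0 :
      lor ((Real.sinh (dist o x))⁻¹ • (Real.cosh (dist o x) • hyp x - hyp o)) (hyp x) = 0 := by
    rw [lor_smul_left, lor_sub_left, lor_smul_left, lor_hyp_self, lor_hyp]
    ring
  refine ⟨(Real.sinh (dist o x))⁻¹ • (Real.cosh (dist o x) • hyp x - hyp o),
    ⟨?_, fun z hz => ?_, x, hx, hx0⟩, hx0, ?_⟩
  · simp only [lor_sub_left, lor_sub_right, lor_smul_left, lor_smul_right, lor_hyp_self, lor_hyp,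
      dist_comm x o]
    field_simp
    linear_combination hsq
  · rw [lor_smul_left, lor_sub_left, lor_smul_left]
    refine mul_nonpos_of_nonneg_of_nonpos (by positivity) ?_
    have h1 : Real.cosh (dist o z) ≤ Real.cosh (dist o x) := by
      rw [Real.cosh_le_cosh, abs_of_nonneg dist_nonneg, abs_of_nonneg dist_nonneg]
      exact hmax z hz
    have h2 := lor_hyp_le x z
    rw [lor_hyp o z]
    nlinarith [Real.cosh_pos (dist o x)]
  · rw [smul_smul, mul_inv_cancel₀ hs.ne', one_smul]
    abel

/-- A body of constant width `w` all of whose projections onto geodesics through `o` have the same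
length has projections of length `w`. -/
lemma projectionLength_eq_width {K : Set ℍ} {w l : ℝ} {o : ℍ} (hK : IsConvexBody K)
    (hC1 : IsC1ClosedCurve (frontier K)) (hw : HasConstantWidth K w) (ho : o ∈ interior K)
    (hl : ∀ G : Set ℍ, IsGeodesic G → o ∈ G → projectionLength G K = l) : l = w := by
  obtain ⟨x, hx, hmax⟩ := hK.isCompact.exists_isMaxOn ⟨o, interior_subset ho⟩
    (continuous_const.dist continuous_id : Continuous fun z => dist o z).continuousOn
  have hne : o ≠ x := by
    rintro rfl
    -- otherwise `K` is a single point, which is its own frontier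
    obtain ⟨γ, -, -, -, -, hr⟩ := hC1
    obtain ⟨z, hz, -⟩ := hr.subset (Set.mem_range_self 0)
    have h1 : dist o z ≤ dist o o := hmax (hK.isCompact.isClosed.frontier_subset hz)
    rw [dist_self] at h1
    rw [← dist_le_zero.1 h1] at hz
    exact hz.2 ho
  obtain ⟨n, hn, hnx, hO⟩ := exists_isSupportNormal_of_farthest hx hne fun z hz => hmax hz
  obtain ⟨hw0, hm⟩ := hw.opposite hK hC1 hn hx hnx
  obtain ⟨k, hk, hkx, hkn⟩ := exists_orthogonal x hnx hn.1
  rw [← projectionLength_eq hw0.le hn hnx hm hk hkx hkn]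
  refine (hl _ (isGeodesic_line hk) ?_).symm
  change lor k (hyp o) = 0
  rw [hO, lor_sub_right, lor_smul_right, lor_smul_right, hkx, hkn]
  ring

/-- If all projections onto geodesics through `o` have length `w`, then all normals of the boundary
pass through `o`. -/
lemma exists_hyp_eq_add_of_projectionLength {K : Set ℍ} {w : ℝ} {o : ℍ} (hK : IsConvexBody K)
    (hC1 : IsC1ClosedCurve (frontier K)) (hw : HasConstantWidth K w)
    (hl : ∀ G : Set ℍ, IsGeodesic G → o ∈ G → projectionLength G K = w) {n : ℝ × ℝ × ℝ}
    (hn : IsSupportNormal K n) {x : ℍ} (hx : x ∈ K) (hnx : lor n (hyp x) = 0) :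
    ∃ a b : ℝ, hyp o = a • hyp x + b • n := by
  have hw0 := (hw.opposite hK hC1 hn hx hnx).1
  -- the foot `y` of the perpendicular from `o` to `line n`
  set s := lor n (hyp o) with hs
  have hN : 0 < √(1 + s ^ 2) := by positivity
  have hNN : √(1 + s ^ 2) ^ 2 = 1 + s ^ 2 := Real.sq_sqrt (by positivity)
  obtain ⟨y, hy⟩ := exists_hyp_eq o (v := (√(1 + s ^ 2))⁻¹ • (hyp o - s • n))
    (by
      simp only [lor_sub_left, lor_sub_right, lor_smul_left, lor_smul_right, lor_hyp_self, hn.1,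
        lor_comm (hyp o) n, ← hs]
      field_simp
      linear_combination hNN)
    (by
      rw [lor_smul_left, lor_sub_left, lor_smul_left, lor_hyp_self, ← hs]
      refine mul_neg_of_pos_of_neg (by positivity) ?_
      nlinarith [sq_nonneg s])
  have hO : hyp o = √(1 + s ^ 2) • hyp y + s • n := by
    rw [hy, smul_smul, mul_inv_cancel₀ hN.ne', one_smul]
    abel
  have hny : lor n (hyp y) = 0 := by
    rw [hy, lor_smul_right, lor_sub_right, lor_smul_right, hn.1, ← hs]
    ring
  obtain ⟨t, ht, hm⟩ := exists_opposite hK.isCompact hn hny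
  obtain ⟨k, hk, hky, hkn⟩ := exists_orthogonal y hny hn.1
  have htw : t = w := by
    rw [← projectionLength_eq ht hn hny hm hk hky hkn]
    refine hl _ (isGeodesic_line hk) ?_
    change lor k (hyp o) = 0
    rw [hO, lor_add_right, lor_smul_right, lor_smul_right, hky, hkn]
    ring
  rw [htw] at hm
  -- `x` lies within distance `w` of the geodesic opposite to `line n`, but `y` is the only point of
  -- `line n` with this property
  have h1 := hw.neg_lor_le hK hC1 hm hx
  rw [lor_sub_left, lor_smul_left, lor_smul_left, hnx] at h1
  have hsw := Real.sinh_pos_iff.2 hw0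
  obtain rfl : y = x := by
    apply eq_of_lor_hyp
    nlinarith
  exact ⟨_, _, hO⟩

/-- All normals of the boundary pass through `o`, so the distance to `o` has derivative zero along
the boundary curve. -/
lemma exists_forall_dist_eq {K : Set ℍ} {w : ℝ} {o : ℍ} (hK : IsConvexBody K)
    (hC1 : IsC1ClosedCurve (frontier K)) (hw : HasConstantWidth K w)
    (hl : ∀ G : Set ℍ, IsGeodesic G → o ∈ G → projectionLength G K = w) :
    ∃ R, ∀ x ∈ frontier K, dist o x = R := by
  obtain ⟨γ, hγ, -, -, -, hr⟩ := id hC1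
  have hγf : ∀ s, ∃ z ∈ frontier K, γ s = z := by
    intro s
    obtain ⟨z, hz, h⟩ := hr.subset (Set.mem_range_self s)
    exact ⟨z, hz, h.symm⟩
  have hγK : ∀ s, ∃ z ∈ K, γ s = z := fun s =>
    (hγf s).imp fun z h => ⟨hK.isCompact.isClosed.frontier_subset h.1, h.2⟩
  have hder : ∀ t, HasDerivAt (fun s => lor (hyp o) (hyp (γ s))) 0 t := by
    intro t
    obtain ⟨x, hx, hxt⟩ := hγf t
    have hd : HasDerivAt γ (deriv γ t) t := (hγ.differentiable one_ne_zero t).hasDerivAt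
    obtain ⟨G, N, -, -, ⟨-, hG, hperp⟩, -⟩ := hw x hx
    obtain ⟨n, hn, rfl⟩ := hG.exists_isSupportNormal hK
    have hnx : lor n (hyp x) = 0 := by
      obtain ⟨n', -, -, -, h1, -, h2, -⟩ := hperp.exists_line
      have : x ∈ line n' := h2
      rwa [← h1] at this
    obtain ⟨a, b, hab⟩ := exists_hyp_eq_add_of_projectionLength hK hC1 hw hl hn
      (hK.isCompact.isClosed.frontier_subset hx) hnx
    refine (hasDerivAt_lor_hyp (hyp o) hd (by rw [hxt]; exact x.im_pos.ne')).congr_deriv ?_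
    rw [hxt, hab, lor_add_left, lor_smul_left, lor_smul_left,
      lor_hypDeriv_eq_zero hn hd hxt hnx hγK, lor_comm, lor_hypDeriv_hyp]
    ring
  have hconst := is_const_of_deriv_eq_zero (fun t => (hder t).differentiableAt)
    fun t => (hder t).deriv
  obtain ⟨x₀, hx₀, h₀⟩ := hγf 0
  refine ⟨dist o x₀, fun x hx => ?_⟩
  obtain ⟨t, ht⟩ := hr.superset (Set.mem_image_of_mem _ hx)
  have h1 := hconst t 0
  simp only [h₀, ht, lor_hyp, neg_inj] at h1
  exact eq_of_cosh_eq dist_nonneg dist_nonneg h1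

/-- A closed set with `o` in its interior whose frontier lies on the sphere of radius `R` around `o`
contains the closed ball. -/
lemma closedBall_subset_of_frontier {K : Set ℍ} {o : ℍ} {R : ℝ} (hK : IsClosed K)
    (ho : o ∈ interior K) (hf : ∀ x ∈ frontier K, dist o x = R) : Metric.closedBall o R ⊆ K := by
  intro p hp
  rw [Metric.mem_closedBall, dist_comm] at hp
  rcases eq_or_ne o p with rfl | hne
  · exact interior_subset ho
  have hd : 0 < dist o p := dist_pos.2 hne
  obtain ⟨c, hc, hc0, hcp⟩ := exists_geodesic_between o p hne
  have hpre : IsPreconnected (c '' Set.Ico 0 (dist o p)) :=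
    isPreconnected_Ico.image c hc.continuous.continuousOn
  -- the half-open segment from `o` to `p` does not meet the frontier of `K`
  have hsub : c '' Set.Ico 0 (dist o p) ⊆ K := by
    refine (hpre.subset_left_of_subset_union isOpen_interior hK.isOpen_compl
      (disjoint_compl_right.mono_left interior_subset) ?_ ?_).trans interior_subset
    · rintro _ ⟨τ, hτ, rfl⟩
      by_contra! h
      rw [Set.mem_union, not_or, Set.notMem_compl_iff] at h
      have h1 := hf (c τ) ⟨subset_closure h.2, h.1⟩
      nth_rewrite 1 [← hc0] at h1
      rw [hc.dist_eq, Real.dist_eq, zero_sub, abs_neg, abs_of_nonneg hτ.1] at h1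
      linarith [hτ.2]
    · exact ⟨o, ⟨0, Set.left_mem_Ico.2 hd, hc0⟩, ho⟩
  have h1 : p ∈ closure (c '' Set.Ico 0 (dist o p)) := by
    have h2 : dist o p ∈ closure (Set.Ico 0 (dist o p)) := by
      rw [closure_Ico hd.ne]
      exact Set.right_mem_Icc.2 hd.le
    have := image_closure_subset_closure_image hc.continuous (Set.mem_image_of_mem c h2)
    rwa [hcp] at this
  exact closure_minimal hsub hK h1

end HypPlane

theorem theorem4p4 (o : ℍ) (K : Set ℍ) (w : ℝ)
    (hK : HypPlane.IsConvexBody K)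
    (hC1 : HypPlane.IsC1ClosedCurve (frontier K))
    (ho : o ∈ interior K)
    (hw : HypPlane.HasConstantWidth K w)
    (hproj : ∃ l : ℝ, ∀ G : Set ℍ, HypPlane.IsGeodesic G → o ∈ G →
      HypPlane.projectionLength G K = l) :
    ∃ (c : ℍ) (r : ℝ), 0 < r ∧ K = Metric.closedBall c r := by
  obtain ⟨l, hl⟩ := hproj
  obtain rfl := HypPlane.projectionLength_eq_width hK hC1 hw ho hl
  obtain ⟨R, hR⟩ := HypPlane.exists_forall_dist_eq hK hC1 hw hl
  have hoK := interior_subset ho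
  obtain ⟨x₁, hx₁⟩ : (frontier K).Nonempty := by
    obtain ⟨γ, -, -, -, -, hr⟩ := hC1
    obtain ⟨z, hz, -⟩ := hr.subset (Set.mem_range_self 0)
    exact ⟨z, hz⟩
  have hR0 : 0 < R := by
    rw [← hR x₁ hx₁, dist_pos]
    rintro rfl
    exact hx₁.2 ho
  refine ⟨o, R, hR0, Set.Subset.antisymm (fun z hz => ?_)
    (HypPlane.closedBall_subset_of_frontier hK.isCompact.isClosed ho hR)⟩
  -- the distance to `o` is maximal at a boundary point, where it equals `R`
  obtain ⟨x, hx, hmax⟩ := hK.isCompact.exists_isMaxOn ⟨o, hoK⟩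
    (continuous_const.dist continuous_id : Continuous fun z => dist o z).continuousOn
  have hne : o ≠ x := by
    rintro rfl
    have h1 : dist o x₁ ≤ dist o o := hmax (hK.isCompact.isClosed.frontier_subset hx₁)
    rw [dist_self, hR x₁ hx₁] at h1
    linarith
  obtain ⟨n, hn, hnx, -⟩ := HypPlane.exists_isSupportNormal_of_farthest hx hne fun z hz => hmax hz
  rw [Metric.mem_closedBall, dist_comm, ← hR x (hn.mem_frontier hx hnx)]
  exact hmax hz
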